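/- A linear decision tree on inputs $x\in\mathbb{R}^n$ is a rooted ternary tree in which every inner node is labelled by a vector $q\in\mathbb{R}^n$ and branches according to $\mathrm{sign}(\langle q,x\rangle)\in\{-,0,+\}$, and every leaf is labelled by an output; its depth is the maximal number of inner nodes on a path from the root to a leaf. For $H\subset\mathbb{R}^n$, it is a comparison decision tree for $H$ if every query $q$ is either a label query, $q\in H$, or a comparison query, $q=h'-h''$ with $h',h''\in H$. Let $H_n=\{0,1\}^n\setminus\{0^n\}$. Theorem. There is an absolute constant $C>0$ such that for every $n\ge 2$ the SUBSET-SUM problem on $n$ real numbers (given $x=(x_1,\dots,x_n)\in\mathbb{R}^n$, decide whether there is a nonempty $I\subseteq\{1,\dots,n\}$ with $\sum_{i\in I}x_i=0$) is solved, for all inputs $x \in \mathbb{R}^n$, by a comparison decision tree for $H_n$ of depth at most $C\,n^2\log n$. Likewise, there is a comparison decision tree for $H_n$ of depth at most $C\,n^2\log n$ that computes, for all $x\in\mathbb{R}^n$, the whole sign vector $\bigl(\mathrm{sign}(\langle h,x\rangle)\bigr)_{h\in H_n}$. In both trees all queries are linear forms with coefficients in $\{-1,0,1\}$, comparing two subset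 sums $\sum_{i\in I}x_i$ and $\sum_{j\in J}x_j$ (where $J=\emptyset$ for label queries). -/

import Mathlib

open scoped Matrix Pointwise

/-- A ternary linear decision tree on inputs `x ∈ ℝⁿ` with outputs in `α`. An inner node asks for
the sign of `⟨h, x⟩` and continues according to the answer in `{-, 0, +}`. -/
inductive LinearDecisionTree (n : ℕ) (α : Type) : Type where
  | leaf (a : α) : LinearDecisionTree n α
  | query (h : Fin n → ℝ) (next : SignType → LinearDecisionTree n α) : LinearDecisionTree n α

namespace LinearDecisionTree

variable {n : ℕ} {α : Type}

/-- The output of the tree on input `x`. -/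
noncomputable def eval (x : Fin n → ℝ) : LinearDecisionTree n α → α
  | leaf a => a
  | query h next => eval x (next (SignType.sign (h ⬝ᵥ x)))

/-- The depth: the largest number of queries on a path from the root to a leaf. -/
def depth : LinearDecisionTree n α → ℕ
  | leaf _ => 0
  | query _ next => 1 + Finset.univ.sup fun s => depth (next s)

/-- The set of all linear forms queried at the inner nodes of the tree. -/
def queries : LinearDecisionTree n α → Set (Fin n → ℝ)
  | leaf _ => ∅
  | query h next => {h} ∪ ⋃ s, queries (next s)

/-- A comparison decision tree for `H`: every query is a label query (an element of `H`) or a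
comparison query (a difference of two elements of `H`). -/
def IsComparison (H : Set (Fin n → ℝ)) (T : LinearDecisionTree n α) : Prop :=
  T.queries ⊆ H ∪ (H - H)

end LinearDecisionTree

/-- The point-location function `x ↦ (sign ⟨h, x⟩ : h ∈ H)`. -/
noncomputable def pointLocation {n : ℕ} (H : Set (Fin n → ℝ)) (x : Fin n → ℝ) : H → SignType :=
  fun h => SignType.sign ((h : Fin n → ℝ) ⬝ᵥ x)

/-- The set `{0,1}ⁿ \ {0ⁿ}`. -/
def subsetVectors (n : ℕ) : Set (Fin n → ℝ) :=
  {h | (∀ i, h i = 0 ∨ h i = 1) ∧ h ≠ 0}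

/-- `x` is a yes-instance of SUBSET-SUM: some nonempty subset of the entries has sum `0`. -/
def SubsetSum {n : ℕ} (x : Fin n → ℝ) : Prop :=
  ∃ I : Finset (Fin n), I.Nonempty ∧ ∑ i ∈ I, x i = 0

/-! The argument rests on inference. Call `h` inferred from `S` at `x` if the signs at `x` of all
`t` and `t - t'` with `t, t' ∈ S` force the sign of `h`. Among `d = O(n log n)` zero-one vectors, at
every `x`, some vector is inferred from the others (`exists_infers_erase`). Sort those of one sign
by `|⟨h, x⟩|`: there are more sets of consecutive differences than possible sums, and two equal sums
express one vector as the first one plus a nonnegative combination of earlier differences.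

Bounded inference dimension makes random samples efficient: `128 d` random elements of `R` fail to
infer at least half of `R` with probability at most `2⁻⁸ᵈ` (`sum_badIndicator_le`). Averaging over
cells gives one sample `S` that works for all but a `2⁻⁸ᵈ` fraction of the cells (`exists_sample`).

Sorting `S` naively would cost an extra logarithm. Binary search weighted by the number of cells
avoids it: an insertion costs two queries plus two for each halving of the number of cells
(`computableWithin_of_sort`). There are only `2 ^ O(n²)` cells, so the halvings cost `O(n²)` over
the whole tree. A good sample halves `R`, which happens at most `n + 1` times and costs `O(d)` each
time; a bad one divides the number of cells by `2⁸ᵈ`, which pays for its round. The total is `O(d n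
+ n²) = O(n² log n)`. -/

/-! ### Random samples under bounded inference dimension. -/

section Sampling

set_option linter.unusedSectionVars false

variable {α : Type*} [Fintype α] [DecidableEq α]

open Classical in
/-- One step of sampling a uniform element `h` and adding it to `T`, weighted by `c` whenever `h`
is not inferred by `T`. -/
noncomputable def weightedStep (I : Finset α → α → Prop) (c : ℝ) (φ : Finset α → ℝ) :
    Finset α → ℝ :=
  fun T => ∑ h, (if I T h then 1 else c) * φ (insert h T)

lemma weightedStep_mono (I : Finset α → α → Prop) {c : ℝ} (hc : 0 ≤ c) {φ ψ : Finset α → ℝ}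
    (h : φ ≤ ψ) : weightedStep I c φ ≤ weightedStep I c ψ := by
  intro T
  refine Finset.sum_le_sum fun a _ => mul_le_mul_of_nonneg_left (h _) ?_
  split_ifs <;> positivity

lemma weightedStep_nonneg (I : Finset α → α → Prop) {c : ℝ} (hc : 0 ≤ c) {φ : Finset α → ℝ}
    (h : 0 ≤ φ) : 0 ≤ weightedStep I c φ := by
  intro T
  refine Finset.sum_nonneg fun a _ => mul_nonneg ?_ (h _)
  split_ifs <;> positivity

lemma sum_fin_succ_eq_sum_insertNth {s : ℕ} (j : Fin (s + 1)) (F : (Fin (s + 1) → α) → ℝ) :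
    ∑ w, F w = ∑ w : Fin s → α, ∑ h, F (j.insertNth h w) := by
  rw [← (Fin.insertNthEquiv (fun _ => α) j).sum_comp, Fintype.sum_prod_type, Finset.sum_comm]
  rfl

lemma image_insertNth {s : ℕ} (j : Fin (s + 1)) (h : α) (w : Fin s → α) :
    Finset.univ.image (j.insertNth h w : Fin (s + 1) → α) = insert h (Finset.univ.image w) := by
  ext a
  simp [Fin.exists_iff_succAbove j, eq_comm]

lemma iterate_weightedStep_one (I : Finset α → α → Prop) (s : ℕ) (φ : Finset α → ℝ) :
    (weightedStep I 1)^[s] φ ∅ = ∑ w : Fin s → α, φ (Finset.univ.image w) := by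
  induction s generalizing φ with
  | zero => simp
  | succ s ih =>
    rw [Function.iterate_succ_apply, ih, sum_fin_succ_eq_sum_insertNth 0]
    refine Finset.sum_congr rfl fun w _ => ?_
    simp only [image_insertNth]
    simp [weightedStep]

/-- If `k` of the `s` sampled elements were not inferred on arrival, the two weights are `2⁻ᵏ` and
`2ᵏ`. Since `a 2⁻ᵏ` and `a⁻¹ 2ᵏ` are mutually inverse, one of them is at least `1`. Thus a bad
sample is charged either to many uninferred arrivals or to few. -/
lemma iterate_weightedStep_one_le (I : Finset α → α → Prop) (s : ℕ) {φ : Finset α → ℝ}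
    (hφ : 0 ≤ φ) (T : Finset α) {a : ℝ} (ha : 0 < a) :
    (weightedStep I 1)^[s] φ T ≤
      a * (weightedStep I (1 / 2))^[s] φ T + a⁻¹ * (weightedStep I 2)^[s] φ T := by
  induction s generalizing T a with
  | zero =>
    have h1 : 1 ≤ a + a⁻¹ := by
      rcases le_total 1 a with h | h
      · have := inv_pos.2 ha; linarith
      · have := (one_le_inv₀ ha).2 h; linarith
    have := mul_le_mul_of_nonneg_right h1 (hφ T)
    simp only [Function.iterate_zero, id]
    simpa [add_mul] using this
  | succ s ih =>
    simp only [Function.iterate_succ_apply']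
    generalize (weightedStep I 1)^[s] φ = f₁ at ih ⊢
    generalize (weightedStep I (1 / 2))^[s] φ = f₂ at ih ⊢
    generalize (weightedStep I 2)^[s] φ = f₃ at ih ⊢
    unfold weightedStep
    rw [Finset.mul_sum, Finset.mul_sum, ← Finset.sum_add_distrib]
    refine Finset.sum_le_sum fun h _ => ?_
    split_ifs with hI
    · simpa using ih (insert h T) ha
    · have := ih (insert h T) (half_pos ha)
      rw [inv_div] at this
      have e : a * (1 / 2 * f₂ (insert h T)) + a⁻¹ * (2 * f₃ (insert h T)) =
          a / 2 * f₂ (insert h T) + 2 / a * f₃ (insert h T) := by ring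
      rw [e, one_mul]
      exact this

open Classical in
/-- The elements that are not inferred by `T`. -/
noncomputable def uninferred (I : Finset α → α → Prop) (T : Finset α) : Finset α :=
  Finset.univ.filter fun h => ¬ I T h

open Classical in
/-- The indicator function of the sets which leave more than half of all elements uninferred. -/
noncomputable def badIndicator (I : Finset α → α → Prop) (T : Finset α) : ℝ :=
  if Fintype.card α < 2 * (uninferred I T).card then 1 else 0

lemma badIndicator_nonneg (I : Finset α → α → Prop) : 0 ≤ badIndicator I := by
  intro T
  unfold badIndicator
  split_ifs <;> simp

lemma badIndicator_anti {I : Finset α → α → Prop}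
    (hmono : ∀ ⦃T T' : Finset α⦄ ⦃h : α⦄, T ⊆ T' → I T h → I T' h) {T T' : Finset α}
    (h : T ⊆ T') : badIndicator I T' ≤ badIndicator I T := by
  unfold badIndicator
  have : (uninferred I T').card ≤ (uninferred I T).card := by
    refine Finset.card_le_card fun a => ?_
    simp only [uninferred, Finset.mem_filter, Finset.mem_univ, true_and]
    exact fun h1 h2 => h1 (hmono h h2)
  split_ifs <;> first | omega | simp

lemma sum_weight (I : Finset α → α → Prop) (c : ℝ) (T : Finset α) [DecidablePred (I T)] :
    ∑ h, (if I T h then 1 else c) = Fintype.card α + (c - 1) * (uninferred I T).card := by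
  have : ∀ h, (if I T h then (1 : ℝ) else c) = 1 + (c - 1) * (if ¬ I T h then 1 else 0) := by
    intro h; split_ifs <;> simp_all
  simp only [this, Finset.sum_add_distrib, ← Finset.mul_sum, Finset.sum_boole]
  simp only [uninferred, Finset.sum_const, Finset.card_univ, nsmul_eq_mul, mul_one]
  congr!

lemma weightedStep_half_badIndicator_le {I : Finset α → α → Prop}
    (hmono : ∀ ⦃T T' : Finset α⦄ ⦃h : α⦄, T ⊆ T' → I T h → I T' h) (T : Finset α) :
    weightedStep I (1 / 2) (badIndicator I) T ≤
      3 / 4 * Fintype.card α * badIndicator I T := by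
  classical
  calc weightedStep I (1 / 2) (badIndicator I) T
      ≤ ∑ h, (if I T h then 1 else 1 / 2) * badIndicator I T := by
        unfold weightedStep
        refine Finset.sum_le_sum fun h _ => ?_
        refine (mul_le_mul_of_nonneg_left
          (badIndicator_anti hmono (Finset.subset_insert h T)) ?_).trans (le_of_eq ?_)
        · split_ifs <;> norm_num
        · congr
    _ = (Fintype.card α + (1 / 2 - 1) * (uninferred I T).card) * badIndicator I T := by
        rw [← Finset.sum_mul, sum_weight]
    _ ≤ _ := by
        by_cases h : Fintype.card α < 2 * (uninferred I T).card
        · have : (Fintype.card α : ℝ) < 2 * (uninferred I T).card := by exact_mod_cast h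
          simp only [badIndicator, h, if_true]
          linarith
        · simp [badIndicator, h]

/-- A final set that is bad was bad throughout, by monotonicity. At each step more than half of the
elements then have weight `1 / 2`, so the average weight is at most `3 / 4`. -/
lemma iterate_weightedStep_half_le {I : Finset α → α → Prop}
    (hmono : ∀ ⦃T T' : Finset α⦄ ⦃h : α⦄, T ⊆ T' → I T h → I T' h) (s : ℕ) (T : Finset α) :
    (weightedStep I (1 / 2))^[s] (badIndicator I) T ≤
      (3 / 4 * Fintype.card α) ^ s * badIndicator I T := by
  induction s generalizing T with
  | zero => simp
  | succ s ih =>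
    rw [Function.iterate_succ_apply']
    refine (weightedStep_mono I (by norm_num) ih T).trans ?_
    have h1 := weightedStep_half_badIndicator_le hmono T
    have h2 : weightedStep I (1 / 2) (fun T => (3 / 4 * (Fintype.card α : ℝ)) ^ s *
        badIndicator I T) T =
        (3 / 4 * Fintype.card α) ^ s * weightedStep I (1 / 2) (badIndicator I) T := by
      unfold weightedStep
      rw [Finset.mul_sum]
      exact Finset.sum_congr rfl fun _ _ => by ring
    rw [h2, pow_succ, mul_assoc]
    exact mul_le_mul_of_nonneg_left h1 (by positivity)

open Classical in
/-- The indices of the entries of `w` that are not inferred by the other entries. -/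
noncomputable def uninferredIndices (I : Finset α → α → Prop) {s : ℕ} (w : Fin (s + 1) → α) :
    Finset (Fin (s + 1)) :=
  Finset.univ.filter fun j => ¬ I (Finset.univ.image (j.removeNth w)) (w j)

open Classical in
-- A repeated value is inferred from its other occurrence, so uninferred positions carry distinct
-- values. With `d` such values, `hdim` would infer one from the others, contradicting its choice.
lemma card_uninferredIndices_lt {I : Finset α → α → Prop} {d : ℕ}
    (hmono : ∀ ⦃T T' : Finset α⦄ ⦃h : α⦄, T ⊆ T' → I T h → I T' h)
    (hself : ∀ ⦃T : Finset α⦄ ⦃h : α⦄, h ∈ T → I T h)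
    (hdim : ∀ D : Finset α, d ≤ D.card → ∃ h ∈ D, I (D.erase h) h)
    {s : ℕ} (w : Fin (s + 1) → α) :
    (uninferredIndices I w).card < d := by
  by_contra! hd
  set J := uninferredIndices I w with hJ
  rw [uninferredIndices] at hJ
  have key : ∀ i j, i ≠ j → w i ∈ Finset.univ.image (j.removeNth w) := by
    intro i j hij
    obtain ⟨k, hk⟩ := Fin.exists_succAbove_eq hij
    exact Finset.mem_image.2 ⟨k, Finset.mem_univ _, by simp [Fin.removeNth, hk]⟩
  have hinj : Set.InjOn w J := by
    intro i hi j hj hij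
    by_contra hne
    have hj' : ¬ I _ (w j) := (Finset.mem_filter.1 hj).2
    exact hj' (hself (hij ▸ key i j hne))
  obtain ⟨h, hh, hI⟩ := hdim (J.image w) (by rwa [Finset.card_image_of_injOn hinj])
  obtain ⟨j, hj, rfl⟩ := Finset.mem_image.1 hh
  refine (Finset.mem_filter.1 hj).2 (hmono ?_ hI)
  intro a ha
  obtain ⟨hne, ha⟩ := Finset.mem_erase.1 ha
  obtain ⟨i, -, rfl⟩ := Finset.mem_image.1 ha
  exact key i j fun h => hne (by rw [h])

open Classical in
-- Symmetrization: in a uniform random sequence the last element may be taken to sit at any position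
-- `j`. Averaging its weight over all `j` gives `1` plus the fraction of uninferred positions, which
-- `B` bounds.
lemma iterate_weightedStep_two_succ_le {I : Finset α → α → Prop} {s : ℕ} {C B : ℝ} (hC : 0 ≤ C)
    (hs : ∀ φ : Finset α → ℝ, 0 ≤ φ →
      (weightedStep I 2)^[s] φ ∅ ≤ C * ∑ w : Fin s → α, φ (Finset.univ.image w))
    (hB : ∀ w : Fin (s + 1) → α, ((uninferredIndices I w).card : ℝ) ≤ (B - 1) * (s + 1))
    (φ : Finset α → ℝ) (hφ : 0 ≤ φ) :
    (weightedStep I 2)^[s + 1] φ ∅ ≤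
      C * B * ∑ w : Fin (s + 1) → α, φ (Finset.univ.image w) := by
  rw [Function.iterate_succ_apply, mul_assoc]
  refine (hs _ (weightedStep_nonneg I (by norm_num) hφ)).trans
    (mul_le_mul_of_nonneg_left ?_ hC)
  have h1 : ∀ j : Fin (s + 1), ∑ w : Fin s → α, weightedStep I 2 φ (Finset.univ.image w) =
      ∑ w : Fin (s + 1) → α, (if I (Finset.univ.image (j.removeNth w)) (w j) then 1 else 2) *
        φ (Finset.univ.image w) := by
    intro j
    rw [sum_fin_succ_eq_sum_insertNth j]
    refine Finset.sum_congr rfl fun w _ => ?_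
    simp [weightedStep, image_insertNth]
  have h2 : ∀ w : Fin (s + 1) → α, ∑ j : Fin (s + 1),
      (if I (Finset.univ.image (j.removeNth w)) (w j) then (1 : ℝ) else 2) ≤ B * (s + 1) := by
    intro w
    have : ∀ j : Fin (s + 1),
        (if I (Finset.univ.image (j.removeNth w)) (w j) then (1 : ℝ) else 2) =
        1 + if ¬ I (Finset.univ.image (j.removeNth w)) (w j) then 1 else 0 := by
      intro j; split_ifs <;> norm_num
    simp only [this, Finset.sum_add_distrib, Finset.sum_boole]
    have := hB w
    rw [uninferredIndices] at this
    simp only [Finset.sum_const, Finset.card_univ, Fintype.card_fin, nsmul_eq_mul, mul_one]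
    push_cast
    linarith
  have h3 : (s + 1 : ℝ) * ∑ w : Fin s → α, weightedStep I 2 φ (Finset.univ.image w) ≤
      (s + 1) * (B * ∑ w : Fin (s + 1) → α, φ (Finset.univ.image w)) := by
    calc (s + 1 : ℝ) * ∑ w : Fin s → α, weightedStep I 2 φ (Finset.univ.image w)
        = ∑ j : Fin (s + 1), ∑ w : Fin s → α, weightedStep I 2 φ (Finset.univ.image w) := by
          simp
      _ = ∑ w : Fin (s + 1) → α, (∑ j : Fin (s + 1),
          (if I (Finset.univ.image (j.removeNth w)) (w j) then (1 : ℝ) else 2)) *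
            φ (Finset.univ.image w) := by
          rw [Finset.sum_congr rfl fun j _ => h1 j, Finset.sum_comm]
          simp only [Finset.sum_mul]
      _ ≤ ∑ w : Fin (s + 1) → α, (B * (s + 1)) * φ (Finset.univ.image w) :=
          Finset.sum_le_sum fun w _ => mul_le_mul_of_nonneg_right (h2 w) (hφ _)
      _ = _ := by rw [← Finset.mul_sum]; ring
  exact le_of_mul_le_mul_left h3 (by positivity)

/-- The first `16 d` steps are charged the trivial factor `2`; afterwards fewer than `d` of more
than `16 d` positions are uninferred, so each step costs at most `1 + 1 / 16`. -/
lemma iterate_weightedStep_two_le {I : Finset α → α → Prop} {d : ℕ}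
    (hmono : ∀ ⦃T T' : Finset α⦄ ⦃h : α⦄, T ⊆ T' → I T h → I T' h)
    (hself : ∀ ⦃T : Finset α⦄ ⦃h : α⦄, h ∈ T → I T h)
    (hdim : ∀ D : Finset α, d ≤ D.card → ∃ h ∈ D, I (D.erase h) h) (m : ℕ) :
    ∀ φ : Finset α → ℝ, 0 ≤ φ → (weightedStep I 2)^[16 * d + m] φ ∅ ≤
      (2 ^ (16 * d) * (17 / 16) ^ m) *
        ∑ w : Fin (16 * d + m) → α, φ (Finset.univ.image w) := by
  induction m with
  | zero =>
    have : ∀ s : ℕ, ∀ φ : Finset α → ℝ, 0 ≤ φ → (weightedStep I 2)^[s] φ ∅ ≤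
        2 ^ s * ∑ w : Fin s → α, φ (Finset.univ.image w) := by
      intro s
      induction s with
      | zero => intro φ _; simp
      | succ s ih =>
        rw [pow_succ]
        refine iterate_weightedStep_two_succ_le (by positivity) ih fun w => ?_
        have := Finset.card_le_univ (uninferredIndices I w)
        rw [Fintype.card_fin] at this
        have : ((uninferredIndices I w).card : ℝ) ≤ (s + 1 : ℕ) := by
            exact_mod_cast this
        push_cast at this
        linarith
    simpa using this (16 * d)
  | succ m ih =>
    rw [pow_succ, ← mul_assoc]
    refine iterate_weightedStep_two_succ_le (by positivity) ih fun w => ?_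
    have h1 := (card_uninferredIndices_lt hmono hself hdim w).le
    have h2 : ((uninferredIndices I w).card : ℝ) ≤ d := by exact_mod_cast h1
    have h3 : (((16 * d).add m : ℕ) : ℝ) = 16 * d + m := by simp [Nat.add_eq]
    rw [h3]
    linarith [(Nat.cast_nonneg m : (0 : ℝ) ≤ m)]

/-- A random sequence of length `128 d` leaves more than half of all elements uninferred with
probability at most `2⁻⁸ᵈ`, when `d` bounds the inference dimension. -/
lemma sum_badIndicator_le {I : Finset α → α → Prop} {d : ℕ} (hd : 0 < d)
    (hmono : ∀ ⦃T T' : Finset α⦄ ⦃h : α⦄, T ⊆ T' → I T h → I T' h)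
    (hself : ∀ ⦃T : Finset α⦄ ⦃h : α⦄, h ∈ T → I T h)
    (hdim : ∀ D : Finset α, d ≤ D.card → ∃ h ∈ D, I (D.erase h) h) :
    2 ^ (8 * d) * ∑ w : Fin (128 * d) → α, badIndicator I (Finset.univ.image w) ≤
      (Fintype.card α : ℝ) ^ (128 * d) := by
  set b := ∑ w : Fin (128 * d) → α, badIndicator I (Finset.univ.image w) with hb
  set N : ℝ := (Fintype.card α : ℝ)
  have hs : 128 * d = 16 * d + 112 * d := by ring
  set c : ℝ := 2 ^ (16 * d) * (17 / 16) ^ (112 * d) with hc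
  have hcpos : 0 < c := by positivity
  have h2 : (weightedStep I 2)^[128 * d] (badIndicator I) ∅ ≤ c * b := by
    have := iterate_weightedStep_two_le hmono hself hdim (112 * d) _ (badIndicator_nonneg I)
    rw [hb, hs]
    exact this
  have h3 : (weightedStep I (1 / 2))^[128 * d] (badIndicator I) ∅ ≤ (3 / 4 * N) ^ (128 * d) := by
    refine (iterate_weightedStep_half_le hmono _ _).trans
      (mul_le_of_le_one_right (by positivity) ?_)
    unfold badIndicator; split_ifs <;> norm_num
  -- With `a = 2 * c` the weight-two term is at most `b / 2` and is absorbed into the left side.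
  have h1 := iterate_weightedStep_one_le I (128 * d) (badIndicator_nonneg I) ∅
    (show 0 < 2 * c by positivity)
  rw [iterate_weightedStep_one, ← hb] at h1
  have h4 : b ≤ 2 * c * (3 / 4 * N) ^ (128 * d) + b / 2 := by
    refine h1.trans (add_le_add (mul_le_mul_of_nonneg_left h3 (by positivity)) ?_)
    calc (2 * c)⁻¹ * _ ≤ (2 * c)⁻¹ * (c * b) := mul_le_mul_of_nonneg_left h2 (by positivity)
      _ = b / 2 := by field_simp
  have h5 : b ≤ 4 * c * (3 / 4) ^ (128 * d) * N ^ (128 * d) := by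
    rw [mul_pow] at h4; linarith
  have h6 : 2 ^ (8 * d) * (4 * c * (3 / 4) ^ (128 * d)) ≤ (1 : ℝ) := by
    have e : (2 : ℝ) ^ (8 * d) * (4 * c * (3 / 4) ^ (128 * d)) =
        4 * (2 ^ 8 * 2 ^ 16 * (17 / 16) ^ 112 * (3 / 4) ^ 128) ^ d := by
      simp only [hc, pow_mul, mul_pow]; ring
    rw [e]
    have h7 : (2 ^ 8 * 2 ^ 16 * (17 / 16) ^ 112 * (3 / 4) ^ 128 : ℝ) ≤ 1 / 4 := by norm_num
    calc (4 : ℝ) * (2 ^ 8 * 2 ^ 16 * (17 / 16) ^ 112 * (3 / 4) ^ 128) ^ d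
        ≤ 4 * (1 / 4) ^ d := by gcongr
      _ ≤ 4 * (1 / 4) ^ 1 := by
          gcongr 4 * ?_
          exact pow_le_pow_of_le_one (by norm_num) (by norm_num) hd
      _ = 1 := by norm_num
  calc 2 ^ (8 * d) * b ≤ 2 ^ (8 * d) * (4 * c * (3 / 4) ^ (128 * d) * N ^ (128 * d)) := by gcongr
    _ = 2 ^ (8 * d) * (4 * c * (3 / 4) ^ (128 * d)) * N ^ (128 * d) := by ring
    _ ≤ 1 * N ^ (128 * d) := by gcongr
    _ = _ := one_mul _

end Sampling

/-! ### Counting the cells of an arrangement. -/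

section Cells

/-- The sign patterns of `M` linear forms on a subspace of dimension at most `r`. -/
lemma ncard_signPatterns_le {E : Type*} [AddCommGroup E] [Module ℝ E] [FiniteDimensional ℝ E]
    {M : ℕ} (q : Fin M → Module.Dual ℝ E) (V : Submodule ℝ E) {r : ℕ}
    (hr : Module.finrank ℝ V ≤ r) :
    ((fun x i => SignType.sign (q i x)) '' (V : Set E)).ncard ≤ (2 * M + 1) ^ r := by
  induction M generalizing V r with
  | zero =>
    refine (Set.ncard_le_one_of_subsingleton _).trans (by simp)
  | succ M ih =>
    set q' : Fin M → Module.Dual ℝ E := fun i => q i.succ with hq'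
    set pat : E → Fin M → SignType := fun x i => SignType.sign (q' i x) with hpat
    set A : SignType → Set (Fin M → SignType) :=
      fun σ => pat '' {x | x ∈ V ∧ SignType.sign (q 0 x) = σ} with hA
    set cons : SignType → (Fin M → SignType) → Fin (M + 1) → SignType :=
      fun σ p => Fin.cons σ p
    have hle : ∀ σ : SignType, (cons σ '' A σ).ncard ≤
        (A σ).ncard := by
      intro σ
      exact Set.ncard_image_le (Set.toFinite (A σ))
    have hsub : (fun x i => SignType.sign (q i x)) '' (V : Set E) ⊆
        (cons 1 '' A 1 ∪ cons (-1) '' A (-1)) ∪ cons 0 '' A 0 := by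
      rintro _ ⟨x, hx, rfl⟩
      have key : (fun i => SignType.sign (q i x)) ∈
          cons (SignType.sign (q 0 x)) '' A (SignType.sign (q 0 x)) := by
        refine ⟨pat x, ⟨x, ⟨hx, rfl⟩, rfl⟩, ?_⟩
        funext i
        refine Fin.cases ?_ (fun i => ?_) i <;> rfl
      rcases h : SignType.sign (q 0 x) with _ | _ | _ <;> rw [h] at key
      · exact Or.inr key
      · exact Or.inl (Or.inr key)
      · exact Or.inl (Or.inl key)
    have htot : ((fun x i => SignType.sign (q i x)) '' (V : Set E)).ncard ≤
        (A 1).ncard + (A (-1)).ncard + (A 0).ncard :=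
      (Set.ncard_le_ncard hsub (Set.toFinite _)).trans ((Set.ncard_union_le _ _).trans
        (add_le_add ((Set.ncard_union_le _ _).trans (add_le_add (hle _) (hle _))) (hle _)))
    -- Two points on opposite sides of `q 0` with the same remaining signs: the positive combination
    -- of them that kills `q 0` keeps those signs. Hence crossing the hyperplane adds at most `2 |A
    -- 0|` patterns, and `A 0` lives in a smaller subspace unless `q 0` vanishes on `V`.
    have hinter : A 1 ∩ A (-1) ⊆ A 0 := by
      rintro _ ⟨⟨x, ⟨hx, hx1⟩, rfl⟩, ⟨y, ⟨hy, hy1⟩, hxy⟩⟩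
      have hx1 : 0 < q 0 x := sign_eq_one_iff.1 hx1
      have hy1 : q 0 y < 0 := sign_eq_neg_one_iff.1 hy1
      refine ⟨(-(q 0 y)) • x + q 0 x • y, ⟨V.add_mem (V.smul_mem _ hx) (V.smul_mem _ hy), ?_⟩, ?_⟩
      · simp [mul_comm]
      · funext i
        have hi : SignType.sign (q' i y) = SignType.sign (q' i x) := congrFun hxy i
        simp only [hpat, map_add, map_smul, smul_eq_mul]
        rcases lt_trichotomy (q' i x) 0 with h | h | h
        · rw [sign_neg h] at hi ⊢
          rw [sign_eq_neg_one_iff] at hi ⊢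
          nlinarith
        · rw [h, sign_zero] at hi ⊢
          rw [sign_eq_zero_iff] at hi ⊢
          simp [hi]
        · rw [sign_pos h] at hi ⊢
          rw [sign_eq_one_iff] at hi ⊢
          nlinarith
    have hunion : (A 1 ∪ A (-1)).ncard ≤ (pat '' (V : Set E)).ncard := by
      refine Set.ncard_le_ncard ?_ (Set.toFinite _)
      rintro _ (⟨x, ⟨hx, -⟩, rfl⟩ | ⟨x, ⟨hx, -⟩, rfl⟩) <;> exact ⟨x, hx, rfl⟩
    have hadd := Set.ncard_union_add_ncard_inter (A 1) (A (-1))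
    have hi := Set.ncard_le_ncard hinter (Set.toFinite _)
    have hVle : (pat '' (V : Set E)).ncard ≤ (2 * M + 1) ^ r := ih q' V hr
    have hpow : (2 * M + 1) ^ r ≤ (2 * (M + 1) + 1) ^ r := Nat.pow_le_pow_left (by omega) r
    by_cases hV : V ≤ LinearMap.ker (q 0)
    · have hz : ∀ x ∈ V, q 0 x = 0 := fun x hx => hV hx
      have e1 : A 1 = ∅ := by
        refine Set.eq_empty_iff_forall_notMem.2 ?_
        rintro _ ⟨x, ⟨hx, hx1⟩, -⟩
        simp [hz x hx] at hx1
      have e2 : A (-1) = ∅ := by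
        refine Set.eq_empty_iff_forall_notMem.2 ?_
        rintro _ ⟨x, ⟨hx, hx1⟩, -⟩
        simp [hz x hx] at hx1
      have e3 : (A 0).ncard ≤ (pat '' (V : Set E)).ncard := by
        refine Set.ncard_le_ncard ?_ (Set.toFinite _)
        rintro _ ⟨x, ⟨hx, -⟩, rfl⟩
        exact ⟨x, hx, rfl⟩
      rw [e1, e2, Set.ncard_empty] at htot
      omega
    · have hlt : Module.finrank ℝ (V ⊓ LinearMap.ker (q 0) : Submodule ℝ E) <
          Module.finrank ℝ V :=
        Submodule.finrank_lt_finrank_of_lt (inf_lt_left.2 hV)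
      obtain ⟨r, rfl⟩ : ∃ r', r = r' + 1 := ⟨r - 1, by omega⟩
      have h0 : (A 0).ncard ≤ (2 * M + 1) ^ r := by
        refine le_trans (Set.ncard_le_ncard ?_ (Set.toFinite _))
          (ih q' (V ⊓ LinearMap.ker (q 0)) (by omega))
        rintro _ ⟨x, ⟨hx, hx0⟩, rfl⟩
        exact ⟨x, ⟨hx, sign_eq_zero_iff.1 hx0⟩, rfl⟩
      calc _ ≤ (2 * M + 1) ^ (r + 1) + 2 * (2 * M + 1) ^ r := by omega
        _ = (2 * M + 1) ^ r * (2 * (M + 1) + 1) := by ring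
        _ ≤ (2 * (M + 1) + 1) ^ r * (2 * (M + 1) + 1) := by gcongr; omega
        _ = _ := by ring

variable {n : ℕ}

/-- The signs of all forms in `Q` at `x`. -/
noncomputable def signPattern (Q : Finset (Fin n → ℝ)) (x : Fin n → ℝ) : Q → SignType :=
  fun q => SignType.sign ((q : Fin n → ℝ) ⬝ᵥ x)

/-- The number of cells of the arrangement `Q` that meet `X`. -/
noncomputable def cellCount (Q : Finset (Fin n → ℝ)) (X : Set (Fin n → ℝ)) : ℕ :=
  (signPattern Q '' X).ncard

lemma cellCount_mono (Q : Finset (Fin n → ℝ)) {X Y : Set (Fin n → ℝ)} (h : X ⊆ Y) :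
    cellCount Q X ≤ cellCount Q Y :=
  Set.ncard_le_ncard (Set.image_mono h) (Set.toFinite _)

lemma cellCount_eq_zero {Q : Finset (Fin n → ℝ)} {X : Set (Fin n → ℝ)} :
    cellCount Q X = 0 ↔ X = ∅ := by
  rw [cellCount, Set.ncard_eq_zero (Set.toFinite _), Set.image_eq_empty]

/-- A form of `Q` that separates `X` from `Y` also separates their cells, so no cell is counted
twice. This is how a query makes progress in the weighted search. -/
lemma cellCount_add_le {Q : Finset (Fin n → ℝ)} {X Y Z : Set (Fin n → ℝ)} (hX : X ⊆ Z)
    (hY : Y ⊆ Z) {q : Fin n → ℝ} (hq : q ∈ Q)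
    (h : ∀ x ∈ X, ∀ y ∈ Y, SignType.sign (q ⬝ᵥ x) ≠ SignType.sign (q ⬝ᵥ y)) :
    cellCount Q X + cellCount Q Y ≤ cellCount Q Z := by
  unfold cellCount
  rw [← Set.ncard_union_eq ?_ (Set.toFinite _) (Set.toFinite _)]
  · exact Set.ncard_le_ncard
      (Set.union_subset (Set.image_mono hX) (Set.image_mono hY)) (Set.toFinite _)
  · rw [Set.disjoint_left]
    rintro _ ⟨x, hx, rfl⟩ ⟨y, hy, hxy⟩
    exact h x hx y hy (congrFun hxy ⟨q, hq⟩).symm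

lemma cellCount_le (Q : Finset (Fin n → ℝ)) (X : Set (Fin n → ℝ)) :
    cellCount Q X ≤ (2 * Q.card + 1) ^ n := by
  refine (cellCount_mono Q (Set.subset_univ X)).trans ?_
  have e : Q.card = Fintype.card Q := by simp
  let f := Fintype.equivFin Q
  have h := ncard_signPatterns_le (E := Fin n → ℝ) (M := Fintype.card Q)
    (fun i => dotProductBilin ℝ ℝ ((f.symm i : Q) : Fin n → ℝ)) ⊤ (r := n) (by simp)
  rw [e]
  refine le_trans (le_of_eq ?_) h
  unfold cellCount
  rw [← Set.ncard_image_of_injective _ (f.arrowCongr (Equiv.refl SignType)).injective,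
    Set.image_image]
  rfl

end Cells

/-! ### Inference dimension of zero-one vectors. -/

section Inference

variable {n : ℕ}

/-- `S` infers `h` at `x` if the signs of the label and comparison queries on `S` at `x` determine
the sign of `⟨h, x⟩`. -/
def Infers (S : Set (Fin n → ℝ)) (x h : Fin n → ℝ) : Prop :=
  ∀ y, (∀ q ∈ S ∪ (S - S), SignType.sign (q ⬝ᵥ y) = SignType.sign (q ⬝ᵥ x)) →
    SignType.sign (h ⬝ᵥ y) = SignType.sign (h ⬝ᵥ x)

lemma Infers.mono {S T : Set (Fin n → ℝ)} {x h : Fin n → ℝ} (hST : S ⊆ T) (hS : Infers S x h) :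
    Infers T x h :=
  fun y hy => hS y fun q hq => hy q (Set.union_subset_union hST (Set.sub_subset_sub hST hST) hq)

lemma Infers.of_mem {S : Set (Fin n → ℝ)} {h : Fin n → ℝ} (x : Fin n → ℝ) (hh : h ∈ S) :
    Infers S x h :=
  fun _ hy => hy h (Or.inl hh)

lemma sign_add_sum_mul {ι : Type*} (s : Finset ι) {a : ℝ} {b c : ι → ℝ} {σ : SignType}
    (ha : SignType.sign a = σ)
    (hb : ∀ i ∈ s, SignType.sign (b i) = 0 ∨ SignType.sign (b i) = σ)
    (hc : ∀ i ∈ s, 0 ≤ c i) : SignType.sign (a + ∑ i ∈ s, c i * b i) = σ := by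
  rcases σ with _ | _ | _
  · have h0 : ∀ i ∈ s, b i = 0 := fun i hi => sign_eq_zero_iff.1 ((hb i hi).elim id id)
    have ha : a = 0 := sign_eq_zero_iff.1 ha
    rw [Finset.sum_eq_zero fun i hi => by rw [h0 i hi, mul_zero], ha]
    simp
  · have ha : a < 0 := sign_eq_neg_one_iff.1 ha
    have h0 : ∀ i ∈ s, c i * b i ≤ 0 := fun i hi => mul_nonpos_of_nonneg_of_nonpos (hc i hi)
      ((hb i hi).elim (fun h => (sign_eq_zero_iff.1 h).le) fun h => (sign_eq_neg_one_iff.1 h).le)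
    exact sign_eq_neg_one_iff.2 (by linarith [Finset.sum_nonpos h0])
  · have ha : 0 < a := sign_eq_one_iff.1 ha
    have h0 : ∀ i ∈ s, 0 ≤ c i * b i := fun i hi => mul_nonneg (hc i hi)
      ((hb i hi).elim (fun h => (sign_eq_zero_iff.1 h).ge) fun h => (sign_eq_one_iff.1 h).le)
    exact sign_eq_one_iff.2 (by linarith [Finset.sum_nonneg h0])

lemma sign_sub_of_abs_le {u v : ℝ} (huv : SignType.sign u = SignType.sign v) (h : |u| ≤ |v|) :
    SignType.sign (v - u) = 0 ∨ SignType.sign (v - u) = SignType.sign v := by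
  rcases lt_trichotomy v 0 with hv | rfl | hv
  · rw [sign_neg hv, sign_eq_neg_one_iff] at huv
    rw [abs_of_neg hv, abs_of_neg huv] at h
    rw [sign_neg hv, sign_eq_neg_one_iff, sign_eq_zero_iff]
    rcases h.eq_or_lt with h | h
    · left; linarith
    · right; linarith
  · rw [sign_zero, sign_eq_zero_iff] at huv
    simp [huv]
  · rw [sign_pos hv, sign_eq_one_iff] at huv
    rw [abs_of_pos hv, abs_of_pos huv] at h
    rw [sign_pos hv, sign_eq_one_iff, sign_eq_zero_iff]
    rcases h.eq_or_lt with h | h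
    · left; linarith
    · right; linarith

/-- Two distinct sets of consecutive differences of a long sequence of `0/1`-vectors have the same
sum. -/
lemma exists_sum_differences_eq {k : ℕ} (hk : (2 * k + 1) ^ n < 2 ^ k) (g : ℕ → Fin n → ℝ)
    (hg : ∀ i j, g i j = 0 ∨ g i j = 1) :
    ∃ A ⊆ Finset.range k, ∃ B ⊆ Finset.range k, A ≠ B ∧
      ∑ i ∈ A, (g (i + 1) - g i) = ∑ i ∈ B, (g (i + 1) - g i) := by
  have hz : ∀ i j, ∃ z : ℤ, |z| ≤ 1 ∧ (z : ℝ) = g (i + 1) j - g i j := by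
    intro i j
    rcases hg (i + 1) j with h1 | h1 <;> rcases hg i j with h2 | h2 <;> rw [h1, h2]
    · exact ⟨0, by norm_num⟩
    · exact ⟨-1, by norm_num⟩
    · exact ⟨1, by norm_num⟩
    · exact ⟨0, by norm_num⟩
  choose z hz1 hz2 using hz
  -- Pigeonhole: the differences have entries in `{-1, 0, 1}`, so the sums over the `2 ^ k` index
  -- sets lie in the box `[-k, k]ⁿ` of integer points.
  have hcard : (Fintype.piFinset fun _ : Fin n => Finset.Icc (-(k : ℤ)) k).card <
      (Finset.range k).powerset.card := by
    rw [Fintype.card_piFinset, Finset.card_powerset, Finset.card_range]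
    refine lt_of_eq_of_lt ?_ hk
    simp only [Int.card_Icc, Finset.prod_const, Finset.card_univ, Fintype.card_fin]
    congr 1
    omega
  obtain ⟨A, hA, B, hB, hne, hAB⟩ := Finset.exists_ne_map_eq_of_card_lt_of_maps_to hcard
    (f := fun A j => ∑ i ∈ A, z i j) (by
      intro A hA
      have hA : A ⊆ Finset.range k := Finset.mem_powerset.1 hA
      have hAk : (A.card : ℤ) ≤ k := by
        have := Finset.card_le_card hA
        rw [Finset.card_range] at this
        exact_mod_cast this
      refine Fintype.mem_piFinset.2 fun j => Finset.mem_Icc.2 (abs_le.1 ?_)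
      calc |∑ i ∈ A, z i j| ≤ ∑ i ∈ A, |z i j| := Finset.abs_sum_le_sum_abs _ _
        _ ≤ ∑ i ∈ A, 1 := Finset.sum_le_sum fun i _ => hz1 i j
        _ ≤ k := by simpa using hAk)
  refine ⟨A, Finset.mem_powerset.1 hA, B, Finset.mem_powerset.1 hB, hne, ?_⟩
  funext j
  have : ((∑ i ∈ A, z i j : ℤ) : ℝ) = (∑ i ∈ B, z i j : ℤ) := by
    exact_mod_cast congrFun hAB j
  push_cast at this
  simpa [Finset.sum_apply, hz2] using this

/-- If the sums of the differences `v (i + 1) - v i` over two distinct sets agree, then some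
`v (p + 1)` is `v 0` plus a nonnegative combination of the preceding differences. -/
lemma exists_eq_add_sum_differences {E : Type*} [AddCommGroup E] [Module ℝ E] (v : ℕ → E) {k : ℕ}
    {A B : Finset ℕ} (hA : A ⊆ Finset.range k) (hB : B ⊆ Finset.range k) (hne : A ≠ B)
    (hAB : ∑ i ∈ A, (v (i + 1) - v i) = ∑ i ∈ B, (v (i + 1) - v i)) :
    ∃ p < k, ∃ c : ℕ → ℝ, (∀ i, 0 ≤ c i) ∧
      v (p + 1) = v 0 + ∑ i ∈ Finset.range p, c i • (v (i + 1) - v i) := by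
  have hnon : (symmDiff A B).Nonempty := by
    rw [Finset.nonempty_iff_ne_empty]
    exact fun h => hne (symmDiff_eq_bot.1 h)
  -- Beyond the last index `p` where the sets differ, all terms cancel. Solving for `v (p + 1) - v
  -- p` leaves coefficients in `{-1, 0, 1}` on earlier differences; adding the telescoping sum `v p
  -- - v 0` raises each by one and makes it nonnegative.
  set p := (symmDiff A B).max' hnon with hp
  have hmem : p ∈ symmDiff A B := Finset.max'_mem _ _
  have hmax : ∀ i, p < i → (i ∈ A ↔ i ∈ B) := by
    intro i hi
    by_contra hcon
    have : i ∈ symmDiff A B := by rw [Finset.mem_symmDiff]; tauto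
    exact absurd (Finset.le_max' _ _ this) (not_le.2 hi)
  clear_value p
  wlog hpA : p ∈ A generalizing A B
  · exact this hB hA hne.symm hAB.symm (symmDiff_comm A B ▸ hnon)
      (by simp only [symmDiff_comm B A]; exact hp) (symmDiff_comm A B ▸ hmem)
      (fun i hi => (hmax i hi).symm) (by rw [Finset.mem_symmDiff] at hmem; tauto)
  have hpB : p ∉ B := by rw [Finset.mem_symmDiff] at hmem; tauto
  have hpk : p < k := Finset.mem_range.1 (hA hpA)
  have hind : ∀ T ⊆ Finset.range k, ∑ i ∈ T, (v (i + 1) - v i) =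
      ∑ i ∈ Finset.range k, (if i ∈ T then (1 : ℝ) else 0) • (v (i + 1) - v i) := by
    intro T hT
    simp only [ite_smul, one_smul, zero_smul]
    rw [Finset.sum_ite_mem, Finset.inter_eq_right.2 hT]
  have hsplit : ∀ f : ℕ → ℝ, (∀ i, p < i → f i = 0) →
      ∑ i ∈ Finset.range k, f i • (v (i + 1) - v i) =
        ∑ i ∈ Finset.range (p + 1), f i • (v (i + 1) - v i) := by
    intro f hf
    refine (Finset.sum_subset (Finset.range_subset_range.2 hpk) fun i _ hi => ?_).symm
    rw [hf i (by simpa using hi), zero_smul]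
  refine ⟨p, hpk, fun i => 1 + ((if i ∈ B then 1 else 0) - (if i ∈ A then 1 else 0)),
    fun i => by beta_reduce; split_ifs <;> norm_num, ?_⟩
  rw [hind A hA, hind B hB, ← sub_eq_zero, ← Finset.sum_sub_distrib] at hAB
  simp only [← sub_smul] at hAB
  rw [hsplit _ fun i hi => by simp [hmax i hi], Finset.sum_range_succ] at hAB
  simp only [hpA, hpB, if_true, if_false, sub_zero, one_smul] at hAB
  have htel := Finset.sum_range_sub v p
  simp only [add_smul, one_smul, Finset.sum_add_distrib, htel, sub_smul, Finset.sum_sub_distrib]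
    at hAB ⊢
  have h2 := eq_neg_of_add_eq_zero_right hAB
  rw [neg_sub] at h2
  rw [← h2]
  abel

/-- With equal signs `σ` and increasing absolute values, each consecutive difference has sign `0` or
`σ`. These signs are known at `y` too, so `g 0` plus a nonnegative combination of them has sign `σ`
there. -/
lemma exists_infers_of_chain {k : ℕ} (hk : (2 * k + 1) ^ n < 2 ^ k) (g : ℕ → Fin n → ℝ)
    (hg : ∀ i j, g i j = 0 ∨ g i j = 1) {x : Fin n → ℝ} {σ : SignType}
    (hσ : ∀ i, SignType.sign (g i ⬝ᵥ x) = σ) (habs : Monotone fun i => |g i ⬝ᵥ x|) :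
    ∃ p < k, Infers (g '' Set.Iic p) x (g (p + 1)) := by
  obtain ⟨A, hA, B, hB, hne, hAB⟩ := exists_sum_differences_eq hk g hg
  obtain ⟨p, hp, c, hc, heq⟩ := exists_eq_add_sum_differences g hA hB hne hAB
  refine ⟨p, hp, fun y hy => ?_⟩
  have hmem : ∀ i ≤ p, g i ∈ g '' Set.Iic p := fun i hi => ⟨i, hi, rfl⟩
  rw [hσ, heq, add_dotProduct, sum_dotProduct]
  simp only [smul_dotProduct, smul_eq_mul]
  refine sign_add_sum_mul _ ?_ (fun i hi => ?_) fun i _ => hc i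
  · rw [hy _ (Or.inl (hmem 0 (Nat.zero_le p))), hσ]
  · have hi : i < p := Finset.mem_range.1 hi
    rw [hy _ (Or.inr (Set.sub_mem_sub (hmem _ hi) (hmem _ hi.le))), sub_dotProduct, ← hσ (i + 1)]
    exact sign_sub_of_abs_le (by rw [hσ, hσ]) (habs (Nat.le_succ i))

/-- The inference dimension of a set of `0/1`-vectors. -/
lemma exists_infers_erase {k : ℕ} (hk : (2 * k + 1) ^ n < 2 ^ k) {D : Finset (Fin n → ℝ)}
    (hD : ∀ h ∈ D, ∀ j, h j = 0 ∨ h j = 1) (hcard : 3 * (k + 1) ≤ D.card) (x : Fin n → ℝ) :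
    ∃ h ∈ D, Infers (D.erase h : Finset (Fin n → ℝ)) x h := by
  -- The factor `3` pays for passing to a single sign class, of size at least `k + 1`.
  obtain ⟨σ, -, hσ⟩ := Finset.exists_le_card_fiber_of_mul_le_card_of_maps_to
    (s := D) (t := (Finset.univ : Finset SignType)) (f := fun h => SignType.sign (h ⬝ᵥ x))
    (n := k + 1) (fun _ _ => Finset.mem_univ _) Finset.univ_nonempty hcard
  obtain ⟨D', hD', hcard'⟩ := Finset.exists_subset_card_eq hσ
  let e : Fin (k + 1) ≃ D' := (Fintype.equivFinOfCardEq (by simpa using hcard')).symm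
  let f : Fin (k + 1) → ℝ := fun i => |((e i : D') : Fin n → ℝ) ⬝ᵥ x|
  let w : Fin (k + 1) → Fin n → ℝ := fun i => (e (Tuple.sort f i) : D')
  have hwinj : Function.Injective w :=
    Subtype.val_injective.comp (e.injective.comp (Tuple.sort f).injective)
  have hwmem : ∀ i, w i ∈ D ∧ SignType.sign (w i ⬝ᵥ x) = σ :=
    fun i => Finset.mem_filter.1 (hD' (e (Tuple.sort f i)).2)
  have hwmono : Monotone fun i => |w i ⬝ᵥ x| := Tuple.monotone_sort f
  -- The chain is continued constantly past `k`; only indices up to `p + 1 ≤ k` matter, and there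
  -- `ι` is injective.
  let ι : ℕ → Fin (k + 1) := fun i => ⟨min i k, by omega⟩
  have hι : Monotone ι := fun i j hij => Fin.mk_le_mk.2 (min_le_min_right k hij)
  obtain ⟨p, hp, hinf⟩ := exists_infers_of_chain hk (fun i => w (ι i))
    (fun i => hD _ (hwmem _).1) (fun i => (hwmem _).2) (hwmono.comp hι)
  refine ⟨_, (hwmem (ι (p + 1))).1, hinf.mono ?_⟩
  rintro _ ⟨i, hi, rfl⟩
  have hi : i ≤ p := hi
  refine Finset.mem_coe.2 (Finset.mem_erase.2 ⟨fun h => ?_, (hwmem _).1⟩)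
  have := Fin.mk.inj_iff.1 (hwinj h)
  omega

end Inference

/-! ### Decision trees and sorting by weighted binary search. -/

section Trees

namespace LinearDecisionTree

/-- Relabel the leaves of a tree. -/
def mapLeaves {n : ℕ} {α β : Type} (f : α → β) :
    LinearDecisionTree n α → LinearDecisionTree n β
  | leaf a => leaf (f a)
  | query h next => query h fun s => mapLeaves f (next s)

variable {n : ℕ} {α β : Type}

lemma eval_mapLeaves (f : α → β) (T : LinearDecisionTree n α) (x : Fin n → ℝ) :
    (T.mapLeaves f).eval x = f (T.eval x) := by
  induction T with
  | leaf a => rfl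
  | query h next ih => exact ih _

lemma depth_mapLeaves (f : α → β) (T : LinearDecisionTree n α) :
    (T.mapLeaves f).depth = T.depth := by
  induction T with
  | leaf a => rfl
  | query h next ih => simp only [mapLeaves, depth, ih]

lemma queries_mapLeaves (f : α → β) (T : LinearDecisionTree n α) :
    (T.mapLeaves f).queries = T.queries := by
  induction T with
  | leaf a => rfl
  | query h next ih => simp only [mapLeaves, queries, ih]

end LinearDecisionTree

variable {n : ℕ} {H : Set (Fin n → ℝ)} {β : Type} {f : (Fin n → ℝ) → β}

/-- Some comparison decision tree for `H` of depth at most `k` computes `f` on `X`. -/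
def ComputableWithin (H : Set (Fin n → ℝ)) (f : (Fin n → ℝ) → β) (X : Set (Fin n → ℝ)) (k : ℕ) :
    Prop :=
  ∃ T : LinearDecisionTree n β, (∀ x ∈ X, T.eval x = f x) ∧ T.IsComparison H ∧ T.depth ≤ k

lemma ComputableWithin.mono {X : Set (Fin n → ℝ)} {k l : ℕ} (h : ComputableWithin H f X k)
    (hkl : k ≤ l) : ComputableWithin H f X l :=
  let ⟨T, h1, h2, h3⟩ := h
  ⟨T, h1, h2, h3.trans hkl⟩

lemma computableWithin_of_forall_eq {X : Set (Fin n → ℝ)} (k : ℕ) (b : β) (h : ∀ x ∈ X, f x = b) :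
    ComputableWithin H f X k :=
  ⟨.leaf b, fun x hx => (h x hx).symm, Set.empty_subset _, Nat.zero_le _⟩

lemma computableWithin_of_empty [Nonempty β] {X : Set (Fin n → ℝ)} (k : ℕ) (h : X = ∅) :
    ComputableWithin H f X k :=
  computableWithin_of_forall_eq k (Classical.arbitrary β) (by simp [h])

lemma computableWithin_query {X : Set (Fin n → ℝ)} {k : ℕ} {q : Fin n → ℝ}
    (hq : q ∈ H ∪ (H - H))
    (h : ∀ σ, ComputableWithin H f {x ∈ X | SignType.sign (q ⬝ᵥ x) = σ} k) :
    ComputableWithin H f X (k + 1) := by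
  choose T h1 h2 h3 using h
  refine ⟨.query q T, fun x hx => h1 _ x ⟨hx, rfl⟩, ?_, ?_⟩
  · exact Set.union_subset (Set.singleton_subset_iff.2 hq) (Set.iUnion_subset h2)
  · rw [LinearDecisionTree.depth, add_comm]
    exact Nat.succ_le_succ (Finset.sup_le fun σ _ => h3 σ)

/-- The sign of `⟨q, x⟩` is the same for all `x ∈ X`. -/
def SignConstOn (q : Fin n → ℝ) (X : Set (Fin n → ℝ)) : Prop :=
  ∀ x ∈ X, ∀ y ∈ X, SignType.sign (q ⬝ᵥ x) = SignType.sign (q ⬝ᵥ y)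

lemma SignConstOn.mono {q : Fin n → ℝ} {X Y : Set (Fin n → ℝ)} (h : SignConstOn q X)
    (hY : Y ⊆ X) : SignConstOn q Y :=
  fun x hx y hy => h x (hY hx) y (hY hy)

lemma signConstOn_sep (q : Fin n → ℝ) (X : Set (Fin n → ℝ)) (σ : SignType) :
    SignConstOn q {x ∈ X | SignType.sign (q ⬝ᵥ x) = σ} :=
  fun _ hx _ hy => hx.2.trans hy.2.symm

lemma SignConstOn.neg {q : Fin n → ℝ} {X : Set (Fin n → ℝ)} (h : SignConstOn q X) :
    SignConstOn (-q) X := by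
  intro x hx y hy
  rw [neg_dotProduct, neg_dotProduct, Left.sign_neg, Left.sign_neg, h x hx y hy]

lemma SignConstOn.of_neg {q : Fin n → ℝ} {X : Set (Fin n → ℝ)} (h : SignConstOn (-q) X) :
    SignConstOn q X := by
  simpa using h.neg

lemma SignConstOn.dotProduct_le {q q' x₀ : Fin n → ℝ} {X : Set (Fin n → ℝ)}
    (h : SignConstOn (q - q') X) (hx₀ : x₀ ∈ X) (hle : q ⬝ᵥ x₀ ≤ q' ⬝ᵥ x₀) :
    ∀ x ∈ X, q ⬝ᵥ x ≤ q' ⬝ᵥ x := by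
  intro x hx
  have := h x hx x₀ hx₀
  rw [sub_dotProduct, sub_dotProduct] at this
  by_contra! hcon
  rw [sign_pos (sub_pos.2 hcon)] at this
  have := sign_eq_one_iff.1 this.symm
  linarith

/-- Once one member of a chain is known to vanish, comparisons with it are labels, so the whole
chain is resolved. -/
lemma SignConstOn.of_forall_eq_zero {q q' : Fin n → ℝ} {X : Set (Fin n → ℝ)}
    (h : SignConstOn (q - q') X) (h0 : ∀ x ∈ X, q' ⬝ᵥ x = 0) : SignConstOn q X := by
  intro x hx y hy
  have := h x hx y hy
  rwa [sub_dotProduct, sub_dotProduct, h0 x hx, h0 y hy, sub_zero, sub_zero] at this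

lemma signConstOn_of_forall_pos {q : Fin n → ℝ} {X : Set (Fin n → ℝ)}
    (h : ∀ x ∈ X, 0 < q ⬝ᵥ x) : SignConstOn q X :=
  fun x hx y hy => by rw [sign_pos (h x hx), sign_pos (h y hy)]

lemma signConstOn_of_forall_neg {q : Fin n → ℝ} {X : Set (Fin n → ℝ)}
    (h : ∀ x ∈ X, q ⬝ᵥ x < 0) : SignConstOn q X :=
  fun x hx y hy => by rw [sign_neg (h x hx), sign_neg (h y hy)]

/-- Weighted binary search: the signs of a chain `D` of queries can be determined at the cost of
two queries plus two for each halving of the number of cells. -/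
lemma computableWithin_of_search [Nonempty β] {Q : Finset (Fin n → ℝ)}
    (hQ : H ∪ (H - H) ⊆ Q) {a : ℕ} (D : Finset (Fin n → ℝ)) (X : Set (Fin n → ℝ))
    (hDH : ∀ q ∈ D, q ∈ H ∪ (H - H))
    (hchain : ∀ q ∈ D, ∀ q' ∈ D, SignConstOn (q - q') X)
    (hleaf : ∀ Y ⊆ X, (∀ q ∈ D, SignConstOn q Y) → ∀ p, cellCount Q Y < 2 ^ p →
      ComputableWithin H f Y (a + 2 * p)) {p : ℕ} (hp : cellCount Q X < 2 ^ p) :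
    ComputableWithin H f X (a + 2 + 2 * p) := by
  classical
  induction hm : D.card using Nat.strong_induction_on generalizing D X p with
  | _ m ih =>
  subst hm
  rcases X.eq_empty_or_nonempty with hX | ⟨x₀, hx₀⟩
  · exact computableWithin_of_empty _ hX
  obtain ⟨p, rfl⟩ : ∃ p', p = p' + 1 := by
    refine ⟨p - 1, ?_⟩
    rcases p with _ | p
    · rw [pow_zero, Nat.lt_one_iff, cellCount_eq_zero] at hp
      exact absurd hx₀ (by simp [hp])
    · rfl
  have hresolved : ∀ Y ⊆ X, (∀ q ∈ D, SignConstOn q Y) →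
      ComputableWithin H f Y (a + 2 * (p + 1)) := fun Y hY h =>
    hleaf Y hY h (p + 1) ((cellCount_mono Q hY).trans_lt hp)
  -- Halving the cells lowers `p` by one, which pays for the two queries of the recursive call.
  -- Erasing the resolved `q` makes the induction on `D.card` go through.
  have hlight : ∀ Y ⊆ X, ∀ q ∈ D, SignConstOn q Y → cellCount Q Y < 2 ^ p →
      ComputableWithin H f Y (a + 2 * (p + 1)) := by
    intro Y hY q hq hqY hYp
    refine (ih (D.erase q).card (Finset.card_erase_lt_of_mem hq) (D.erase q) Y
      (fun q' h => hDH q' (Finset.mem_of_mem_erase h))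
      (fun q' h q'' h' => (hchain q' (Finset.mem_of_mem_erase h) q''
        (Finset.mem_of_mem_erase h')).mono hY) (fun Z hZ h => hleaf Z (hZ.trans hY) ?_)
        hYp rfl).mono (by omega)
    intro q' hq'
    by_cases e : q' = q
    · exact e ▸ hqY.mono hZ
    · exact h q' (Finset.mem_erase.2 ⟨e, hq'⟩)
  have hzero : ∀ Y ⊆ X, ∀ q ∈ D, (∀ x ∈ Y, q ⬝ᵥ x = 0) →
      ComputableWithin H f Y (a + 2 * (p + 1)) := fun Y hY q hq h =>
    hresolved Y hY fun q' hq' => ((hchain q' hq' q hq).mono hY).of_forall_eq_zero h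
  -- All points of `X` order `D` in the same way. The largest heavy form is queried first: a
  -- positive answer discards at least `2 ^ p` of fewer than `2 ^ (p + 1)` cells, and a negative one
  -- settles every heavy form. The smallest light form comes next: a negative answer leaves fewer
  -- than `2 ^ p` cells, and a positive one settles every light form.
  let heavy := D.filter fun q => 2 ^ p ≤ cellCount Q {x ∈ X | q ⬝ᵥ x ≤ 0}
  let light := D.filter fun q => ¬ 2 ^ p ≤ cellCount Q {x ∈ X | q ⬝ᵥ x ≤ 0}
  have hsecond : ∀ Y ⊆ X, (∀ q ∈ heavy, ∀ x ∈ Y, q ⬝ᵥ x < 0) →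
      ComputableWithin H f Y (a + 2 * (p + 1) + 1) := by
    intro Y hY hneg
    rcases light.eq_empty_or_nonempty with he | hne
    · refine (hresolved Y hY fun q hq => signConstOn_of_forall_neg (hneg q ?_)).mono (by omega)
      by_contra hcon
      have : q ∈ light := Finset.mem_filter.2 ⟨hq, fun h => hcon (Finset.mem_filter.2 ⟨hq, h⟩)⟩
      simp [he] at this
    obtain ⟨q, hq, hmin⟩ := Finset.exists_min_image light (fun q => q ⬝ᵥ x₀) hne
    obtain ⟨hqD, hql⟩ := Finset.mem_filter.1 hq
    refine computableWithin_query (hDH q hqD) fun σ => ?_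
    have hsub : {x ∈ Y | SignType.sign (q ⬝ᵥ x) = σ} ⊆ X := (Set.sep_subset _ _).trans hY
    rcases σ with _ | _ | _
    · exact hzero _ hsub q hqD fun x hx => sign_eq_zero_iff.1 hx.2
    · refine hlight _ hsub q hqD (signConstOn_sep q Y _) ?_
      refine (cellCount_mono Q ?_).trans_lt (not_le.1 hql)
      exact fun x hx => ⟨hY hx.1, (sign_eq_neg_one_iff.1 hx.2).le⟩
    · refine hresolved _ hsub fun q' hq' => ?_
      by_cases h : q' ∈ heavy
      · exact signConstOn_of_forall_neg fun x hx => hneg q' h x hx.1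
      · have hl : q' ∈ light :=
          Finset.mem_filter.2 ⟨hq', fun h' => h (Finset.mem_filter.2 ⟨hq', h'⟩)⟩
        exact signConstOn_of_forall_pos fun x hx => lt_of_lt_of_le (sign_eq_one_iff.1 hx.2)
          ((hchain q hqD q' hq').dotProduct_le hx₀ (hmin q' hl) x (hY hx.1))
  rcases heavy.eq_empty_or_nonempty with he | hne
  · exact (hsecond X subset_rfl (by simp [he])).mono (by omega)
  obtain ⟨q, hq, hmax⟩ := Finset.exists_max_image heavy (fun q => q ⬝ᵥ x₀) hne
  obtain ⟨hqD, hqh⟩ := Finset.mem_filter.1 hq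
  have : ComputableWithin H f X (a + 2 * (p + 1) + 1 + 1) := by
    refine computableWithin_query (hDH q hqD) fun σ => ?_
    have hsub : {x ∈ X | SignType.sign (q ⬝ᵥ x) = σ} ⊆ X := Set.sep_subset _ _
    rcases σ with _ | _ | _
    · exact (hzero _ hsub q hqD fun x hx => sign_eq_zero_iff.1 hx.2).mono (by omega)
    · refine hsecond _ hsub fun q' hq' x hx => lt_of_le_of_lt ?_ (sign_eq_neg_one_iff.1 hx.2)
      exact (hchain q' (Finset.mem_filter.1 hq').1 q hqD).dotProduct_le hx₀ (hmax q' hq') x hx.1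
    · refine (hlight _ hsub q hqD (signConstOn_sep q X _) ?_).mono (by omega)
      have := cellCount_add_le (Q := Q) hsub
        (Set.sep_subset X fun x => q ⬝ᵥ x ≤ 0) (hQ (hDH q hqD)) fun x hx y hy h => by
          have h1 : 0 < q ⬝ᵥ y := sign_eq_one_iff.1 (h ▸ hx.2)
          exact absurd hy.2 (not_le.2 h1)
      rw [pow_succ] at hp
      omega
  exact this.mono (by omega)

/-- The signs of all label and comparison queries on `S` are constant on `X`. -/
def Resolved (S X : Set (Fin n → ℝ)) : Prop :=
  ∀ q ∈ S ∪ (S - S), SignConstOn q X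

/-- Sorting `S` by insertion with weighted binary search. -/
lemma computableWithin_of_sort [Nonempty β] {Q : Finset (Fin n → ℝ)}
    (hQ : H ∪ (H - H) ⊆ Q) {a : ℕ} (S : Finset (Fin n → ℝ)) (hS : (S : Set (Fin n → ℝ)) ⊆ H)
    (X : Set (Fin n → ℝ))
    (hleaf : ∀ Y ⊆ X, Resolved S Y → ∀ p, cellCount Q Y < 2 ^ p →
      ComputableWithin H f Y (a + 2 * p)) {p : ℕ} (hp : cellCount Q X < 2 ^ p) :
    ComputableWithin H f X (a + 2 * S.card + 2 * p) := by
  classical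
  induction S using Finset.induction_on generalizing a p with
  | empty =>
    simpa using hleaf X subset_rfl (by simp [Resolved]) p hp
  | insert h S hh ih =>
    have hS' : (S : Set (Fin n → ℝ)) ⊆ H := fun t ht => hS (by simp at ht; simp [ht])
    have hhH : h ∈ H := hS (by simp)
    rw [Finset.card_insert_of_notMem hh]
    have := ih (a := a + 2) hS' (fun Y hY hres p hp => ?_) hp
    · exact this.mono (by omega)
    -- Inserting `h` into the sorted `S` means finding the signs of `h` and of all `h - t`.
    -- Differences of these are, up to sign, labels or comparisons on `S`, hence already resolved,
    -- so they form a chain.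
    refine computableWithin_of_search hQ (insert h (S.image fun t => h - t)) Y ?_ ?_ ?_ hp
    · intro q hq
      rcases Finset.mem_insert.1 hq with rfl | hq
      · exact Or.inl hhH
      · obtain ⟨t, ht, rfl⟩ := Finset.mem_image.1 hq
        exact Or.inr (Set.sub_mem_sub hhH (hS' ht))
    · have hself : ∀ X : Set (Fin n → ℝ), SignConstOn 0 X := fun X x _ y _ => by simp
      intro q hq q' hq'
      rcases Finset.mem_insert.1 hq with rfl | hq <;>
        rcases Finset.mem_insert.1 hq' with rfl | hq'
      · rw [sub_self]; exact hself Y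
      · obtain ⟨t, ht, rfl⟩ := Finset.mem_image.1 hq'
        rw [sub_sub_cancel]
        exact hres t (Or.inl ht)
      · obtain ⟨t, ht, rfl⟩ := Finset.mem_image.1 hq
        rw [sub_sub_cancel_left]
        exact (hres t (Or.inl ht)).neg
      · obtain ⟨t, ht, rfl⟩ := Finset.mem_image.1 hq
        obtain ⟨t', ht', rfl⟩ := Finset.mem_image.1 hq'
        rw [sub_sub_sub_cancel_left]
        exact hres _ (Or.inr (Set.sub_mem_sub ht' ht))
    · intro Z hZ hconst p hp
      refine hleaf Z (hZ.trans hY) ?_ p hp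
      have hdiff : ∀ t ∈ S, SignConstOn (h - t) Z := fun t ht =>
        hconst _ (Finset.mem_insert_of_mem (Finset.mem_image_of_mem _ ht))
      rw [Finset.coe_insert]
      rintro q (hq | ⟨t, ht, t', ht', rfl⟩)
      · rcases hq with rfl | hq
        · exact hconst q (Finset.mem_insert_self _ _)
        · exact (hres q (Or.inl hq)).mono hZ
      · rcases ht with rfl | ht <;> rcases ht' with rfl | ht'
        · intro x _ y _; simp
        · exact hdiff _ ht'
        · refine SignConstOn.of_neg ?_
          rw [neg_sub]
          exact hdiff _ ht
        · exact (hres _ (Or.inr (Set.sub_mem_sub ht ht'))).mono hZ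

lemma Infers.signConstOn {S X : Set (Fin n → ℝ)} {x h : Fin n → ℝ} (hS : Infers S x h)
    (hX : Resolved S X) (hx : x ∈ X) : SignConstOn h X := by
  have key : ∀ y ∈ X, SignType.sign (h ⬝ᵥ y) = SignType.sign (h ⬝ᵥ x) := fun y hy =>
    hS y fun q hq => hX q hq y hy x hx
  exact fun y hy z hz => (key y hy).trans (key z hz).symm

end Trees

/-! ### Rounds of sampling, sorting and inference. -/

section Rounds

variable {n : ℕ} {H : Set (Fin n → ℝ)} {β : Type} {f : (Fin n → ℝ) → β}

lemma Infers.congr {S : Set (Fin n → ℝ)} {x y h : Fin n → ℝ}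
    (hxy : ∀ q ∈ S ∪ (S - S), SignType.sign (q ⬝ᵥ x) = SignType.sign (q ⬝ᵥ y))
    (hx : Infers S x h) : Infers S y h := by
  intro z hz
  rw [hx z fun q hq => (hz q hq).trans (hxy q hq).symm, hx y fun q hq => (hxy q hq).symm]

open Classical in
/-- The elements of `R` whose sign at `x` is not determined by the queries on `S`. -/
noncomputable def undetermined (R S : Finset (Fin n → ℝ)) (x : Fin n → ℝ) :
    Finset (Fin n → ℝ) :=
  R.filter fun h => ¬ Infers S x h

lemma undetermined_congr {R S : Finset (Fin n → ℝ)} {x y : Fin n → ℝ}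
    (hxy : ∀ q ∈ (S : Set (Fin n → ℝ)) ∪ (S - S),
      SignType.sign (q ⬝ᵥ x) = SignType.sign (q ⬝ᵥ y)) :
    undetermined R S x = undetermined R S y := by
  classical
  unfold undetermined
  refine Finset.filter_congr fun h _ => not_congr ⟨Infers.congr hxy, Infers.congr ?_⟩
  exact fun q hq => (hxy q hq).symm

/-- The inputs at which the queries on `S` leave more than half of `R` undetermined. -/
def badInputs (R S : Finset (Fin n → ℝ)) : Set (Fin n → ℝ) :=
  {x | R.card < 2 * (undetermined R S x).card}

/-- Double counting over pairs of a sequence and a cell. Since `Q` contains all queries on `R`,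
whether an input is bad for `S` depends only on its cell, so one representative per cell suffices.
-/
lemma exists_sample {Q R : Finset (Fin n → ℝ)} {d : ℕ} (hd : 0 < d)
    (hR : (R ∪ (R - R) : Set (Fin n → ℝ)) ⊆ Q)
    (hdim : ∀ x, ∀ D ⊆ R, d ≤ D.card → ∃ h ∈ D, Infers (D.erase h : Finset (Fin n → ℝ)) x h)
    (X : Set (Fin n → ℝ)) :
    ∃ S ⊆ R, S.card ≤ 128 * d ∧
      2 ^ (8 * d) * cellCount Q (X ∩ badInputs R S) ≤ cellCount Q X := by
  classical
  rcases R.eq_empty_or_nonempty with rfl | hne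
  · refine ⟨∅, subset_rfl, by simp, ?_⟩
    have : X ∩ badInputs ∅ ∅ = ∅ := by
      ext x; simp [badInputs, undetermined]
    rw [this, cellCount_eq_zero.2 rfl]
    simp
  let I : (Fin n → ℝ) → Finset R → R → Prop := fun x T h =>
    Infers (T.map (Function.Embedding.subtype _) : Finset (Fin n → ℝ)) x h
  have hbad : ∀ x, 2 ^ (8 * d) * ∑ w : Fin (128 * d) → R,
      badIndicator (I x) (Finset.univ.image w) ≤ (R.card : ℝ) ^ (128 * d) := by
    intro x
    have := sum_badIndicator_le (I := I x) hd ?_ ?_ ?_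
    · simpa using this
    · exact fun T T' h hT => Infers.mono (Finset.coe_subset.2 (Finset.map_subset_map.2 hT))
    · intro T h hT
      exact Infers.of_mem x (Finset.mem_coe.2 (Finset.mem_map_of_mem _ hT))
    · intro D hD
      obtain ⟨h, hh, hinf⟩ := hdim x (D.map (Function.Embedding.subtype _)) (by
        intro a ha
        obtain ⟨b, -, rfl⟩ := Finset.mem_map.1 ha
        exact b.2) (by rwa [Finset.card_map])
      obtain ⟨g, hg, rfl⟩ := Finset.mem_map.1 hh
      refine ⟨g, hg, ?_⟩
      simp only [I, Finset.map_erase]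
      exact hinf
  have hfin : (signPattern Q '' X).Finite := Set.toFinite _
  have hrep : ∀ p ∈ signPattern Q '' X, ∃ x, signPattern Q x = p := by
    rintro _ ⟨x, -, rfl⟩
    exact ⟨x, rfl⟩
  choose! rep hrep using hrep
  have hsum : ∑ w : Fin (128 * d) → R, 2 ^ (8 * d) *
      ∑ p ∈ hfin.toFinset, badIndicator (I (rep p)) (Finset.univ.image w) ≤
      ∑ w : Fin (128 * d) → R, (cellCount Q X : ℝ) := by
    rw [← Finset.mul_sum, Finset.sum_comm, Finset.mul_sum]
    refine (Finset.sum_le_sum fun p _ => hbad (rep p)).trans (le_of_eq ?_)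
    simp [cellCount, Set.ncard_eq_toFinset_card _ hfin, mul_comm]
  have : Nonempty R := hne.to_subtype
  obtain ⟨w, -, hw⟩ := Finset.exists_le_of_sum_le Finset.univ_nonempty hsum
  set T := Finset.univ.image w with hT
  set S : Finset (Fin n → ℝ) := T.map (Function.Embedding.subtype _) with hS
  have hSR : S ⊆ R := by
    intro a ha
    obtain ⟨b, -, rfl⟩ := Finset.mem_map.1 ha
    exact b.2
  have hSQ : (S ∪ (S - S) : Set (Fin n → ℝ)) ⊆ Q := by
    have hSR' : (S : Set (Fin n → ℝ)) ⊆ R := Finset.coe_subset.2 hSR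
    exact (Set.union_subset_union hSR' (Set.sub_subset_sub hSR' hSR')).trans hR
  refine ⟨S, hSR, ?_, ?_⟩
  · rw [hS, Finset.card_map]
    exact Finset.card_image_le.trans (by simp)
  have hind : ∀ x, badIndicator (I x) T = if x ∈ badInputs R S then 1 else 0 := by
    intro x
    have : (uninferred (I x) T).card = (undetermined R S x).card := by
      rw [← Finset.card_map (Function.Embedding.subtype _)]
      congr 1
      ext a
      simp [uninferred, undetermined, I, hS, and_comm]
    simp only [badIndicator, badInputs, this, Set.mem_ofPred_eq, Fintype.card_coe]
    congr
  have hcount : (cellCount Q (X ∩ badInputs R S) : ℝ) ≤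
      ∑ p ∈ hfin.toFinset, badIndicator (I (rep p)) T := by
    simp only [hind, Finset.sum_boole]
    rw [cellCount, Nat.cast_le, ← Set.ncard_coe_finset]
    refine Set.ncard_le_ncard ?_ (Set.toFinite _)
    rintro _ ⟨x, ⟨hx, hxb⟩, rfl⟩
    have hp : signPattern Q x ∈ signPattern Q '' X := ⟨x, hx, rfl⟩
    refine Finset.mem_coe.2 (Finset.mem_filter.2 ⟨hfin.mem_toFinset.2 hp, ?_⟩)
    have := undetermined_congr (R := R) (S := S) (x := rep (signPattern Q x)) (y := x)
      fun q hq => congrFun (hrep _ hp) ⟨q, hSQ hq⟩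
    rw [badInputs, Set.mem_ofPred_eq, this]
    exact hxb
  have : (2 : ℝ) ^ (8 * d) * cellCount Q (X ∩ badInputs R S) ≤ cellCount Q X :=
    (mul_le_mul_of_nonneg_left hcount (by positivity)).trans hw
  exact_mod_cast this

/-- If the inference dimension of `H` is at most `d`, a function of the signs of the elements of
`H` is computed with `O(d)` queries per halving of the set of undetermined elements and `O(1)`
queries per halving of the number of cells. -/
lemma computableWithin_of_inference [Nonempty β] {Q : Finset (Fin n → ℝ)}
    (hQ : H ∪ (H - H) ⊆ Q) {d : ℕ} (hd : 0 < d)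
    (hdim : ∀ x, ∀ D : Finset (Fin n → ℝ), (D : Set (Fin n → ℝ)) ⊆ H → d ≤ D.card →
      ∃ h ∈ D, Infers (D.erase h : Finset (Fin n → ℝ)) x h)
    (hf : ∀ x y, (∀ h ∈ H, SignType.sign (h ⬝ᵥ x) = SignType.sign (h ⬝ᵥ y)) → f x = f y)
    (r p : ℕ) (X : Set (Fin n → ℝ)) (R : Finset (Fin n → ℝ)) (hR : (R : Set (Fin n → ℝ)) ⊆ H)
    (hRr : R.card < 2 ^ r) (hconst : ∀ h ∈ H, h ∉ R → SignConstOn h X)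
    (hp : cellCount Q X < 2 ^ p) : ComputableWithin H f X (256 * d * r + 34 * p) := by
  classical
  classical
  induction r generalizing p X R with
  | zero =>
    have hR0 : R = ∅ := by simpa using hRr
    rcases X.eq_empty_or_nonempty with hX | ⟨x₀, hx₀⟩
    · exact computableWithin_of_empty _ hX
    · exact computableWithin_of_forall_eq _ (f x₀) fun x hx =>
        hf x x₀ fun h hh => hconst h hh (by simp [hR0]) x hx x₀ hx₀
  | succ r ihr =>
    induction p using Nat.strong_induction_on generalizing X with
    | _ p ihp =>
    obtain ⟨S, hSR, hScard, hS⟩ := exists_sample (Q := Q) hd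
      ((Set.union_subset_union hR (Set.sub_subset_sub hR hR)).trans hQ)
      (fun x D hD => hdim x D ((Finset.coe_subset.2 hD).trans hR)) X
    -- Budget: sorting takes at most `256 * d` queries for the sample, plus `2` per halving. The
    -- reserve `32 * p` is kept for the leaves: a bad leaf loses a factor `2 ^ (8 * d)` of cells,
    -- and `32 * (8 * d) = 256 * d` refunds its round.
    refine (computableWithin_of_sort hQ (a := 256 * d * r + 32 * p) S
      ((Finset.coe_subset.2 hSR).trans hR) X (fun Y hY hres p' hp' => ?_) hp).mono
      (by rw [mul_add]; omega)
    rcases Y.eq_empty_or_nonempty with hYe | ⟨y, hy⟩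
    · exact computableWithin_of_empty _ hYe
    by_cases hbad : y ∈ badInputs R S
    · have hYbad : Y ⊆ X ∩ badInputs R S := fun z hz => ⟨hY hz, by
        rw [badInputs, Set.mem_ofPred_eq, undetermined_congr fun q hq => hres q hq z hz y hy]
        exact hbad⟩
      have h1 : 2 ^ (8 * d) * cellCount Q Y < 2 ^ p :=
        ((Nat.mul_le_mul_left _ (cellCount_mono Q hYbad)).trans hS).trans_lt hp
      have hpos : 0 < cellCount Q Y := by
        rw [Nat.pos_iff_ne_zero, Ne, cellCount_eq_zero]
        exact Set.Nonempty.ne_empty ⟨y, hy⟩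
      have hdp : 8 * d < p := by
        refine (Nat.pow_lt_pow_iff_right (by norm_num : 1 < 2)).1 (lt_of_le_of_lt ?_ h1)
        exact Nat.le_mul_of_pos_right _ hpos
      obtain ⟨t, rfl⟩ := Nat.exists_eq_add_of_lt hdp
      have h2 : cellCount Q Y < 2 ^ (t + 1) := by
        rw [add_assoc, pow_add] at h1
        exact lt_of_mul_lt_mul_left h1 (Nat.zero_le _)
      -- Both bounds on the cells of `Y` are needed: `t + 1` provides the refund, while `p'`
      -- accounts for the halvings already paid for in sorting.
      refine (ihp (min p' (t + 1)) (by omega) Y (fun h hh hhR => (hconst h hh hhR).mono hY)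
        ?_).mono ?_
      · rcases min_choice p' (t + 1) with h | h <;> rw [h] <;> assumption
      · rw [mul_add (256 * d)]
        omega
    · have hcard : (undetermined R S y).card < 2 ^ r := by
        simp only [badInputs, Set.mem_ofPred_eq, not_lt] at hbad
        rw [pow_succ] at hRr
        omega
      have hsub : undetermined R S y ⊆ R := Finset.filter_subset _ _
      refine (ihr (min p' p) Y (undetermined R S y) ((Finset.coe_subset.2 hsub).trans hR) hcard
        (fun h hh hhU => ?_) ?_).mono (by omega)
      · by_cases hhR : h ∈ R
        · have : Infers S y h := by
            by_contra hcon
            exact hhU (Finset.mem_filter.2 ⟨hhR, hcon⟩)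
          exact this.signConstOn hres hy
        · exact (hconst h hh hhR).mono hY
      · rcases min_choice p' p with h | h <;> rw [h]
        · exact hp'
        · exact (cellCount_mono Q hY).trans_lt hp

end Rounds

/-! ### Application to zero-one vectors and numerical bounds. -/

section SubsetSum

variable {n : ℕ}

/-- The vectors with entries in `{-1, 0, 1}`. -/
noncomputable def ternaryVectors (n : ℕ) : Finset (Fin n → ℝ) :=
  Fintype.piFinset fun _ => {-1, 0, 1}

lemma mem_ternaryVectors {q : Fin n → ℝ} :
    q ∈ ternaryVectors n ↔ ∀ i, q i = -1 ∨ q i = 0 ∨ q i = 1 := by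
  simp [ternaryVectors]

lemma card_ternaryVectors_le : (ternaryVectors n).card ≤ 3 ^ n := by
  rw [ternaryVectors, Fintype.card_piFinset]
  simp only [Finset.prod_const, Finset.card_univ, Fintype.card_fin]
  exact Nat.pow_le_pow_left Finset.card_le_three n

lemma subsetVectors_union_sub_subset :
    subsetVectors n ∪ (subsetVectors n - subsetVectors n) ⊆ ternaryVectors n := by
  rintro q (hq | ⟨a, ha, b, hb, rfl⟩) <;> refine mem_ternaryVectors.2 fun i => ?_
  · exact Or.inr (hq.1 i)
  · rcases ha.1 i with h | h <;> rcases hb.1 i with h' | h' <;> simp [h, h']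

lemma cellCount_ternaryVectors_lt (hn : n ≠ 0) (X : Set (Fin n → ℝ)) :
    cellCount (ternaryVectors n) X < 2 ^ ((2 * n + 2) * n) := by
  refine (cellCount_le _ X).trans_lt ?_
  rw [pow_mul]
  refine Nat.pow_lt_pow_left ?_ hn
  have h1 : (3 : ℕ) ^ n ≤ 4 ^ n := Nat.pow_le_pow_left (by norm_num) n
  have h2 : 0 < (4 : ℕ) ^ n := by positivity
  have h3 := card_ternaryVectors_le (n := n)
  have h4 : (2 : ℕ) ^ (2 * n + 2) = 4 * 4 ^ n := by rw [pow_add, pow_mul]; norm_num; ring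
  omega

lemma exists_finset_subsetVectors (n : ℕ) :
    ∃ R : Finset (Fin n → ℝ), (R : Set (Fin n → ℝ)) = subsetVectors n ∧ R.card < 2 ^ (n + 1) := by
  classical
  refine ⟨(Fintype.piFinset fun _ => ({0, 1} : Finset ℝ)).filter (· ≠ 0), ?_, ?_⟩
  · ext h
    simp [subsetVectors]
  · refine (Finset.card_filter_le _ _).trans_lt ?_
    rw [Fintype.card_piFinset]
    simp only [Finset.prod_const, Finset.card_univ, Fintype.card_fin]
    exact (Nat.pow_le_pow_left Finset.card_le_two n).trans_lt
      (Nat.pow_lt_pow_right (by norm_num) (Nat.lt_succ_self n))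

/-- Fixes the chain length `k = 8 n L`, with `L` the bit length of `n`. As `n, L < 2 ^ L`, the base
is at most `2 ^ (4 + 2 * L)`, and `n * (4 + 2 * L) < 8 * n * L` because `L ≥ 2`. -/
lemma two_mul_add_one_pow_lt (hn : 2 ≤ n) :
    (2 * (8 * n * n.size) + 1) ^ n < 2 ^ (8 * n * n.size) := by
  set L := n.size with hL
  have hnL : n < 2 ^ L := Nat.lt_size_self n
  have hLL : L < 2 ^ L := Nat.lt_two_pow_self
  have hL2 : 2 ≤ L := Nat.lt_size.2 (by simpa using hn)
  have h1 : n * L + 1 ≤ 2 ^ L * 2 ^ L := Nat.mul_lt_mul'' hnL hLL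
  have h2 : 2 * (8 * n * L) + 1 ≤ 2 ^ (4 + 2 * L) := by
    have e : (2 : ℕ) ^ (4 + 2 * L) = 16 * (2 ^ L * 2 ^ L) := by rw [pow_add, two_mul, pow_add]; rfl
    rw [e]
    nlinarith
  refine (Nat.pow_le_pow_left h2 n).trans_lt ?_
  rw [← pow_mul]
  refine Nat.pow_lt_pow_right (by norm_num) ?_
  nlinarith

lemma size_le_three_mul_log (hn : 2 ≤ n) : (n.size : ℝ) ≤ 3 * Real.log n := by
  obtain ⟨l, hl⟩ : ∃ l, n.size = l + 2 :=
    ⟨n.size - 2, by have : 1 < n.size := Nat.lt_size.2 (by simpa using hn)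
                    omega⟩
  have h1 : 2 ^ (l + 1) ≤ n := Nat.lt_size.1 (by omega)
  have h2 : (l + 1 : ℝ) * Real.log 2 ≤ Real.log n := by
    have : ((2 : ℝ) ^ (l + 1)) ≤ n := by exact_mod_cast h1
    have := Real.log_le_log (by positivity) this
    rw [Real.log_pow] at this
    exact_mod_cast this
  -- The estimate needs `l + 2 ≤ 3 * 0.69 * (l + 1)`, which is nearly tight at `l = 0`.
  have h3 : (0.69 : ℝ) ≤ Real.log 2 := by linarith [Real.log_two_gt_d9]
  have h4 : (l + 1 : ℝ) * 0.69 ≤ (l + 1) * Real.log 2 := by gcongr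
  rw [hl]
  push_cast
  have : (0 : ℝ) ≤ l := Nat.cast_nonneg l
  linarith

lemma computableWithin_pointLocation (hn : 2 ≤ n) :
    ComputableWithin (subsetVectors n) (pointLocation (subsetVectors n)) Set.univ
      (13960 * n ^ 2 * n.size) := by
  obtain ⟨R, hR, hRcard⟩ := exists_finset_subsetVectors n
  refine (computableWithin_of_inference (f := pointLocation (subsetVectors n))
    subsetVectors_union_sub_subset (d := 3 * (8 * n * n.size + 1)) (by positivity)
    (fun x D hD hcard => exists_infers_erase (two_mul_add_one_pow_lt hn)
      (fun h hh => (hD hh).1) hcard x) (fun x y hxy => funext fun h => hxy h h.2)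
    (n + 1) ((2 * n + 2) * n) Set.univ R hR.subset hRcard (fun h hh hhR => ?_)
    (cellCount_ternaryVectors_lt (by omega) _)).mono ?_
  · rw [← hR] at hh
    exact absurd hh hhR
  · have hL : 1 ≤ n.size := Nat.lt_size.2 (by simpa using (by omega : 1 ≤ n))
    have h1 : 256 * (3 * (8 * n * n.size + 1)) ≤ 6912 * (n * n.size) := by nlinarith
    have h2 : n ^ 2 ≤ n ^ 2 * n.size := Nat.le_mul_of_pos_right _ hL
    calc 256 * (3 * (8 * n * n.size + 1)) * (n + 1) + 34 * ((2 * n + 2) * n)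
        ≤ 6912 * (n * n.size) * (2 * n) + 34 * ((4 * n) * n) := by gcongr <;> omega
      _ = 13824 * (n ^ 2 * n.size) + 136 * n ^ 2 := by ring
      _ ≤ 13960 * n ^ 2 * n.size := by linarith

lemma subsetSum_iff {x : Fin n → ℝ} :
    SubsetSum x ↔ ∃ h, pointLocation (subsetVectors n) x h = 0 := by
  classical
  constructor
  · rintro ⟨I, ⟨i, hi⟩, hsum⟩
    refine ⟨⟨fun j => if j ∈ I then 1 else 0, fun j => ?_, fun h => ?_⟩, ?_⟩
    · by_cases hj : j ∈ I <;> simp [hj]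
    · simpa [hi] using congrFun h i
    · simp [pointLocation, dotProduct, hsum]
  · rintro ⟨⟨h, h01, hne⟩, hsum⟩
    refine ⟨Finset.univ.filter fun j => h j = 1, ?_, ?_⟩
    · obtain ⟨i, hi⟩ := Function.ne_iff.1 hne
      exact ⟨i, Finset.mem_filter.2 ⟨Finset.mem_univ i, (h01 i).resolve_left hi⟩⟩
    · rw [← sign_eq_zero_iff.1 hsum, Finset.sum_filter]
      refine Finset.sum_congr rfl fun j _ => ?_
      rcases h01 j with hj | hj <;> simp [hj]

end SubsetSum

theorem mainTheorem7 :
    ∃ C : ℝ, 0 < C ∧ ∀ n : ℕ, 2 ≤ n →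
      (∃ T : LinearDecisionTree n Bool,
        (∀ x : Fin n → ℝ, T.eval x = true ↔ SubsetSum x) ∧
        T.IsComparison (subsetVectors n) ∧
        (∀ q ∈ T.queries, ∀ i, q i = -1 ∨ q i = 0 ∨ q i = 1) ∧
        (T.depth : ℝ) ≤ C * (n : ℝ) ^ 2 * Real.log n) ∧
      (∃ T : LinearDecisionTree n (subsetVectors n → SignType),
        (∀ x : Fin n → ℝ, T.eval x = pointLocation (subsetVectors n) x) ∧
        T.IsComparison (subsetVectors n) ∧
        (∀ q ∈ T.queries, ∀ i, q i = -1 ∨ q i = 0 ∨ q i = 1) ∧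
        (T.depth : ℝ) ≤ C * (n : ℝ) ^ 2 * Real.log n) := by
  classical
  refine ⟨41880, by norm_num, fun n hn => ?_⟩
  obtain ⟨T, heval, hcomp, hdepth⟩ := computableWithin_pointLocation hn
  have hternary : ∀ q ∈ T.queries, ∀ i, q i = -1 ∨ q i = 0 ∨ q i = 1 := fun q hq =>
    mem_ternaryVectors.1 (subsetVectors_union_sub_subset (hcomp hq))
  have hbound : (T.depth : ℝ) ≤ 41880 * (n : ℝ) ^ 2 * Real.log n := by
    calc (T.depth : ℝ) ≤ 13960 * (n : ℝ) ^ 2 * n.size := by exact_mod_cast hdepth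
      _ ≤ 13960 * (n : ℝ) ^ 2 * (3 * Real.log n) := by
          gcongr
          exact size_le_three_mul_log hn
      _ = 41880 * (n : ℝ) ^ 2 * Real.log n := by ring
  refine ⟨⟨T.mapLeaves fun v => decide (∃ h, v h = 0), fun x => ?_, ?_, ?_, ?_⟩,
    T, fun x => heval x (Set.mem_univ x), hcomp, hternary, hbound⟩
  · rw [LinearDecisionTree.eval_mapLeaves, heval x (Set.mem_univ x), decide_eq_true_iff,
      subsetSum_iff]
  · rwa [LinearDecisionTree.IsComparison, LinearDecisionTree.queries_mapLeaves]
  · rwa [LinearDecisionTree.queries_mapLeaves]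
  · rwa [LinearDecisionTree.depth_mapLeaves]
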